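/- Let $\mathscr{H}$ be a complex Hilbert space. For $0<p<\infty$ let $\mathbb{B}_p(\mathscr{H})$ be the Schatten class of all compact operators $X$ on $\mathscr{H}$ with $\sum_j s_j(X)^p<\infty$, where the $s_j(X)$ are the singular values of $X$, i.e. the eigenvalues of $|X|=(X^*X)^{1/2}$ counted with multiplicity, and put $\|X\|_p=\big(\sum_j s_j(X)^p\big)^{1/p}$. Let $n\ge 1$ and $\omega_j=\exp(2\pi i j/n)$ for $j=0,\dots,n-1$. Let $0<p<\infty$ and $A_1,\dots,A_n\in\mathbb{B}_p(\mathscr{H})$. Then $\sum_{j=1}^n\omega_{j-1}^{k-1}A_j\in\mathbb{B}_p(\mathscr{H})$ for $k=1,\dots,n$ and $\sum_{j=1}^n|A_j|^2\in\mathbb{B}_{p/2}(\mathscr{H})$. If $p\ge 2$, then \[ \sum_{k=1}^n\Big\|\sum_{j=1}^n\omega_{j-1}^{k-1}A_j\Big\|_p^p\le n^{p/2}\,\Big\|\sum_{j=1}^n|A_j|^2\Big\|_{p/2}^{p/2}. \] If $0<p\le 2$, then the reverse inequality holds: \[ n^{p/2}\,\Big\|\sum_{j=1}^n|A_j|^2\Big\|_{p/2}^{p/2}\le\sum_{k=1}^n\Big\|\sum_{j=1}^n\omega_{j-1}^{k-1}A_j\Big\|_p^p.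 \] -/

import Mathlib

noncomputable section

namespace Schatten

variable {H : Type*} [NormedAddCommGroup H] [InnerProductSpace ℂ H] [CompleteSpace H]

/-- The multiplicity of `s > 0` as a singular value of the compact operator `X`: the dimension of
the eigenspace of `|X| = (X* X)^(1/2)` for the eigenvalue `s` (finite, as `X` is compact). -/
def singularMultiplicity (X : H →L[ℂ] H) (s : ℝ) : ℕ :=
  Module.finrank ℂ
    (Module.End.eigenspace ((CFC.abs X : H →L[ℂ] H) : H →ₗ[ℂ] H) (s : ℂ))

/-- The sum `∑ⱼ sⱼ(X)^p ∈ [0, ∞]` over the nonzero singular values of a compact operator `X`,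
that is, over the nonzero eigenvalues of `|X|`, counted with multiplicity. -/
def singularSum (p : ℝ) (X : H →L[ℂ] H) : ENNReal :=
  ∑' s : {s : ℝ // 0 < s},
    (singularMultiplicity X (s : ℝ) : ENNReal) * ENNReal.ofReal ((s : ℝ) ^ p)

/-- Membership in the Schatten class `B_p(H)`, for `0 < p < ∞`. -/
def MemSchatten (p : ℝ) (X : H →L[ℂ] H) : Prop :=
  IsCompactOperator X ∧ singularSum p X < ⊤

/-- The Schatten (quasi-)norm `‖X‖_p = (∑ⱼ sⱼ(X)^p)^(1/p)` of `X ∈ B_p(H)`. -/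
def schattenNorm (p : ℝ) (X : H →L[ℂ] H) : ℝ :=
  (singularSum p X).toReal ^ (1 / p)

/-- The `n`-th root of unity `ω_j = exp(2 π i j / n)`. -/
def rootOfUnity (n j : ℕ) : ℂ :=
  Complex.exp (2 * (Real.pi : ℂ) * Complex.I * (j : ℂ) / (n : ℂ))

end Schatten

end

/-! Since `‖X‖ₚᵖ = tr (|X|²) ^ (p/2)` and the columns of the Fourier matrix are orthogonal, which
gives `∑ₖ |Bₖ|² = n ∑ⱼ |Aⱼ|²` for the transforms `Bₖ` of the `Aⱼ`, the claim is McCarthy's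
inequality `∑ₖ tr Sₖ ^ q ≤ tr (∑ₖ Sₖ) ^ q` for positive compact `Sₖ` and `q ≥ 1`, and its reverse
for `q ≤ 1`.

Let `R = ∑ₖ Sₖ` have eigenpairs `(rᵢ, eᵢ)`, and let `(s, f)` be an eigenpair of `Sₖ` with `f` a unit
vector. From `s |f⟩⟨f| ≤ R` follows `s ⟨f, R⁻¹ f⟩ ≤ 1`, so that the `s rᵢ⁻¹ |⟨eᵢ, f⟩|²` are weights
of mass at most one with respect to which the `rᵢ` have mean `s`. Jensen's inequality then gives
`s ^ q ≤ s ⟨f, R ^ (q - 1) f⟩`, or the reverse for `q ≤ 1`, and it remains to sum over `f` and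
`k`. -/

open scoped ENNReal NNReal InnerProductSpace Matrix

namespace Schatten

section Jensen

variable {ι : Type*} {q : ℝ} {w : ι → ℝ≥0∞}

theorem rpow_tsum_mul_le (hq : 1 ≤ q) (hw : ∑' i, w i ≤ 1) (f : ι → ℝ≥0∞) :
    (∑' i, w i * f i) ^ q ≤ ∑' i, w i * f i ^ q := by
  have hq0 : 0 < q := one_pos.trans_le hq
  rw [← ENNReal.le_rpow_inv_iff hq0, ENNReal.tsum_eq_iSup_sum]
  refine iSup_le fun s => ?_
  have hmass : (∑ i ∈ s, w i) ^ (1 - q⁻¹) ≤ 1 :=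
    ENNReal.rpow_le_one ((ENNReal.sum_le_tsum s).trans hw)
      (sub_nonneg.2 (inv_le_one_of_one_le₀ hq))
  calc ∑ i ∈ s, w i * f i
      ≤ (∑ i ∈ s, w i) ^ (1 - q⁻¹) * (∑ i ∈ s, w i * f i ^ q) ^ q⁻¹ :=
        ENNReal.inner_le_weight_mul_Lp_of_nonneg s hq w f
    _ ≤ 1 * (∑' i, w i * f i ^ q) ^ q⁻¹ := by
        gcongr
        exact ENNReal.sum_le_tsum s
    _ = (∑' i, w i * f i ^ q) ^ q⁻¹ := one_mul _

theorem tsum_mul_rpow_le (hq : 0 < q) (hq1 : q ≤ 1) (hw : ∑' i, w i ≤ 1) (f : ι → ℝ≥0∞) :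
    ∑' i, w i * f i ^ q ≤ (∑' i, w i * f i) ^ q := by
  have h := rpow_tsum_mul_le (one_le_inv_iff₀.2 ⟨hq, hq1⟩) hw fun i => f i ^ q
  rw [ENNReal.rpow_inv_le_iff hq] at h
  simpa only [ENNReal.rpow_rpow_inv hq.ne'] using h

end Jensen

section Eigenvalues

variable {𝕜 H ι κ : Type*} [RCLike 𝕜] [NormedAddCommGroup H] [InnerProductSpace 𝕜 H]

section HilbertBasis

theorem hasSum_mul_norm_inner_sq (e : HilbertBasis ι 𝕜 H) {x y : H} {r : ι → ℝ≥0}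
    (h : ∀ i, ⟪e i, y⟫_𝕜 = (r i : ℝ) * ⟪e i, x⟫_𝕜) :
    HasSum (fun i => (r i : ℝ) * ‖⟪e i, x⟫_𝕜‖ ^ 2) (RCLike.re ⟪x, y⟫_𝕜) := by
  refine (RCLike.hasSum_re 𝕜 (e.hasSum_inner_mul_inner x y)).congr_fun fun i => ?_
  rw [h, mul_left_comm, ← inner_conj_symm x, RCLike.conj_mul]
  norm_cast

theorem tsum_mul_enorm_inner_sq (e : HilbertBasis ι 𝕜 H) {x y : H} {r : ι → ℝ≥0}
    (h : ∀ i, ⟪e i, y⟫_𝕜 = (r i : ℝ) * ⟪e i, x⟫_𝕜) :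
    ∑' i, (r i : ℝ≥0∞) * ‖⟪e i, x⟫_𝕜‖ₑ ^ 2 = ENNReal.ofReal (RCLike.re ⟪x, y⟫_𝕜) := by
  have hsum := hasSum_mul_norm_inner_sq e h
  rw [← hsum.tsum_eq, ENNReal.ofReal_tsum_of_nonneg (fun i => by positivity) hsum.summable]
  refine tsum_congr fun i => ?_
  rw [ENNReal.ofReal_mul (r i).coe_nonneg, ENNReal.ofReal_coe_nnreal,
    ENNReal.ofReal_pow (norm_nonneg _), ofReal_norm]

theorem tsum_enorm_inner_sq (e : HilbertBasis ι 𝕜 H) (x : H) :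
    ∑' i, ‖⟪e i, x⟫_𝕜‖ₑ ^ 2 = ‖x‖ₑ ^ 2 := by
  have h := tsum_mul_enorm_inner_sq e (x := x) (y := x) (r := 1) (by simp)
  simpa [inner_self_eq_norm_sq, ENNReal.ofReal_pow] using h

theorem enorm_inner_symm (x y : H) : ‖⟪x, y⟫_𝕜‖ₑ = ‖⟪y, x⟫_𝕜‖ₑ := by
  rw [← ofReal_norm, norm_inner_symm, ofReal_norm]

theorem enorm_hilbertBasis (e : HilbertBasis ι 𝕜 H) (i : ι) : ‖e i‖ₑ = 1 := by
  rw [← ofReal_norm, e.orthonormal.norm_eq_one, ENNReal.ofReal_one]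

end HilbertBasis

/-- A Hilbert basis of eigenvectors of `T` with nonnegative eigenvalues, in which the powers of `T`
are computed. -/
structure Eigenbasis (T : H →L[𝕜] H) (ι : Type*) where
  basis : HilbertBasis ι 𝕜 H
  value : ι → ℝ≥0
  apply_basis : ∀ i, T (basis i) = ((value i : ℝ) : 𝕜) • basis i

namespace Eigenbasis

variable {R S T : H →L[𝕜] H} (D : Eigenbasis T ι) (E : Eigenbasis S κ)

theorem inner_basis_apply (i : ι) (x : H) :
    ⟪D.basis i, T x⟫_𝕜 = (D.value i : ℝ) * ⟪D.basis i, x⟫_𝕜 := by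
  classical
  suffices h : (innerSL 𝕜 (D.basis i)).comp T =
      ((D.value i : ℝ) : 𝕜) • innerSL 𝕜 (D.basis i) from congrArg (· x) h
  refine ContinuousLinearMap.ext_on
    (Submodule.dense_iff_topologicalClosure_eq_top.2 D.basis.dense_span) ?_
  rintro _ ⟨j, rfl⟩
  obtain rfl | hij := eq_or_ne i j
  · simp [D.apply_basis]
  · simp [D.apply_basis, D.basis.orthonormal.inner_eq_zero hij]

theorem isPositive (D : Eigenbasis T ι) : T.IsPositive := by
  refine ⟨fun x y => ?_, fun x => ?_⟩
  · change ⟪T x, y⟫_𝕜 = ⟪x, T y⟫_𝕜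
    rw [← D.basis.tsum_inner_mul_inner (T x) y, ← D.basis.tsum_inner_mul_inner x (T y)]
    refine tsum_congr fun i => ?_
    rw [← inner_conj_symm (T x), D.inner_basis_apply, D.inner_basis_apply, map_mul,
      RCLike.conj_ofReal, inner_conj_symm]
    ring
  · change 0 ≤ RCLike.re ⟪T x, x⟫_𝕜
    rw [inner_re_symm]
    exact (hasSum_mul_norm_inner_sq D.basis (D.inner_basis_apply · x)).nonneg
      fun i => by positivity

/-- The quadratic form `x ↦ ⟨x, T ^ t x⟩`. For `t < 0` a component of `x` in the kernel of `T`
makes it infinite, since `0 ^ t = ∞` in `[0, ∞]`. -/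
noncomputable def powForm (t : ℝ) (x : H) : ℝ≥0∞ :=
  ∑' i, (D.value i : ℝ≥0∞) ^ t * ‖⟪D.basis i, x⟫_𝕜‖ₑ ^ 2

/-- The trace of `T ^ q`, for `q > 0`. -/
noncomputable def powSum (q : ℝ) : ℝ≥0∞ :=
  ∑' i, (D.value i : ℝ≥0∞) ^ q

theorem powForm_zero (x : H) : D.powForm 0 x = ‖x‖ₑ ^ 2 := by
  simp only [powForm, ENNReal.rpow_zero, one_mul, tsum_enorm_inner_sq]

theorem powForm_one (x : H) : D.powForm 1 x = ENNReal.ofReal (RCLike.re ⟪x, T x⟫_𝕜) := by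
  simp only [powForm, ENNReal.rpow_one]
  exact tsum_mul_enorm_inner_sq D.basis fun i => D.inner_basis_apply i x

theorem powForm_basis (t : ℝ) (i : ι) :
    D.powForm t (D.basis i) = (D.value i : ℝ≥0∞) ^ t := by
  rw [powForm, tsum_eq_single i fun j hj => by simp [D.basis.orthonormal.inner_eq_zero hj],
    inner_self_eq_norm_sq_to_K, D.basis.orthonormal.norm_eq_one]
  simp

theorem value_mul_enorm_inner_sq_le_powForm_one (i : ι) (x : H) :
    (D.value i : ℝ≥0∞) * ‖⟪D.basis i, x⟫_𝕜‖ₑ ^ 2 ≤ D.powForm 1 x := by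
  rw [powForm]
  refine le_of_eq_of_le ?_ (ENNReal.le_tsum i)
  rw [ENNReal.rpow_one]

theorem tsum_rpow_mul_powForm (t u : ℝ) :
    ∑' j, (E.value j : ℝ≥0∞) ^ t * D.powForm u (E.basis j) =
      ∑' i, (D.value i : ℝ≥0∞) ^ u * E.powForm t (D.basis i) := by
  simp only [powForm, ← ENNReal.tsum_mul_left]
  rw [ENNReal.tsum_comm]
  refine tsum_congr fun i => tsum_congr fun j => ?_
  rw [enorm_inner_symm, mul_left_comm]

theorem tsum_powForm_basis (q : ℝ) : ∑' j, D.powForm q (E.basis j) = D.powSum q := by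
  simpa only [powSum, ENNReal.rpow_zero, one_mul, powForm_zero, enorm_hilbertBasis, one_pow,
    mul_one] using D.tsum_rpow_mul_powForm E 0 q

theorem rpow_powForm_one_le {q : ℝ} (hq : 1 ≤ q) {x : H} (hx : ‖x‖ₑ = 1) :
    D.powForm 1 x ^ q ≤ D.powForm q x := by
  have hmass : ∑' i, ‖⟪D.basis i, x⟫_𝕜‖ₑ ^ 2 ≤ 1 := by simp [tsum_enorm_inner_sq, hx]
  simpa only [powForm, ENNReal.rpow_one, mul_comm] using
    rpow_tsum_mul_le hq hmass fun i => (D.value i : ℝ≥0∞)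

theorem powForm_one_mono {D : Eigenbasis T ι} {E : Eigenbasis S κ} (h : S ≤ T) (x : H) :
    E.powForm 1 x ≤ D.powForm 1 x := by
  rw [powForm_one, powForm_one]
  refine ENNReal.ofReal_le_ofReal (sub_nonneg.1 ?_)
  simpa [inner_sub_right] using
    ((ContinuousLinearMap.le_def _ _).1 h).re_inner_nonneg_right x

section RankOne

/-- The truncation of `T⁻¹ x` to the basis vectors in `F`. As `0⁻¹ = 0`, components in the kernel of
`T` are dropped. -/
noncomputable def truncInv (F : Finset ι) (x : H) : H :=
  ∑ i ∈ F, (((D.value i)⁻¹ : ℝ) * ⟪D.basis i, x⟫_𝕜) • D.basis i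

theorem enorm_inner_truncInv (F : Finset ι) (x : H) :
    ‖⟪x, D.truncInv F x⟫_𝕜‖ₑ =
      (∑ i ∈ F, (D.value i)⁻¹ * ‖⟪D.basis i, x⟫_𝕜‖₊ ^ 2 : ℝ≥0) := by
  have h : ⟪x, D.truncInv F x⟫_𝕜 =
      ((∑ i ∈ F, (D.value i)⁻¹ * ‖⟪D.basis i, x⟫_𝕜‖₊ ^ 2 : ℝ≥0) : ℝ) := by
    rw [truncInv, inner_sum]
    push_cast
    refine Finset.sum_congr rfl fun i _ => ?_
    rw [inner_smul_right, mul_assoc, ← inner_conj_symm x, RCLike.mul_conj]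
  rw [h, ← ofReal_norm, RCLike.norm_of_nonneg (NNReal.coe_nonneg _), ENNReal.ofReal_coe_nnreal]

theorem powForm_one_truncInv (F : Finset ι) (x : H) :
    D.powForm 1 (D.truncInv F x) =
      (∑ i ∈ F, (D.value i)⁻¹ * ‖⟪D.basis i, x⟫_𝕜‖₊ ^ 2 : ℝ≥0) := by
  classical
  have hinner (i : ι) : ⟪D.basis i, D.truncInv F x⟫_𝕜 =
      if i ∈ F then ((D.value i)⁻¹ : ℝ) * ⟪D.basis i, x⟫_𝕜 else 0 := by
    simp [truncInv, inner_sum, inner_smul_right, orthonormal_iff_ite.1 D.basis.orthonormal]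
  rw [powForm, tsum_eq_sum (s := F) fun i hi => by simp [hinner, hi], ENNReal.ofNNReal_finsetSum]
  refine Finset.sum_congr rfl fun i hi => ?_
  have hcancel : D.value i * (((D.value i)⁻¹ * ‖⟪D.basis i, x⟫_𝕜‖₊) ^ 2) =
      (D.value i)⁻¹ * ‖⟪D.basis i, x⟫_𝕜‖₊ ^ 2 := by
    obtain h | h := eq_or_ne (D.value i) 0
    · simp [h]
    · field_simp
  rw [hinner, if_pos hi, ENNReal.rpow_one, ← hcancel]
  simp [enorm_eq_nnnorm, nnnorm_mul]

variable {D} {s : ℝ≥0} {f : H}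

theorem inner_basis_eq_zero (h : ∀ y, (s : ℝ≥0∞) * ‖⟪f, y⟫_𝕜‖ₑ ^ 2 ≤ D.powForm 1 y) (hs : s ≠ 0)
    {i : ι} (hi : D.value i = 0) : ⟪D.basis i, f⟫_𝕜 = 0 := by
  simpa [D.powForm_basis, hi, hs, inner_eq_zero_symm] using h (D.basis i)

theorem mul_powForm_neg_one_le_one (h : ∀ y, (s : ℝ≥0∞) * ‖⟪f, y⟫_𝕜‖ₑ ^ 2 ≤ D.powForm 1 y) :
    s * D.powForm (-1) f ≤ 1 := by
  obtain rfl | hs := eq_or_ne s 0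
  · simp
  have hterm (i : ι) : (D.value i : ℝ≥0∞) ^ (-1 : ℝ) * ‖⟪D.basis i, f⟫_𝕜‖ₑ ^ 2 =
      ((D.value i)⁻¹ * ‖⟪D.basis i, f⟫_𝕜‖₊ ^ 2 : ℝ≥0) := by
    obtain hi | hi := eq_or_ne (D.value i) 0
    · simp [inner_basis_eq_zero h hs hi]
    · simp [ENNReal.rpow_neg_one, ENNReal.coe_inv hi, enorm_eq_nnnorm]
  simp only [powForm, hterm]
  rw [← ENNReal.tsum_mul_left, ENNReal.tsum_eq_iSup_sum]
  refine iSup_le fun F => ?_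
  have hF := h (D.truncInv F f)
  rw [enorm_inner_truncInv, powForm_one_truncInv] at hF
  rw [← Finset.mul_sum, ← ENNReal.ofNNReal_finsetSum]
  set a := ∑ i ∈ F, (D.value i)⁻¹ * ‖⟪D.basis i, f⟫_𝕜‖₊ ^ 2
  norm_cast at hF ⊢
  obtain ha | ha := eq_or_ne a 0
  · simp [ha]
  · exact le_of_mul_le_mul_right (by rwa [one_mul, mul_assoc, ← sq]) (pos_iff_ne_zero.2 ha)

theorem mul_rpow_mul_enorm_inner_sq
    (h : ∀ y, (s : ℝ≥0∞) * ‖⟪f, y⟫_𝕜‖ₑ ^ 2 ≤ D.powForm 1 y) (q : ℝ) (i : ι) :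
    s * ((D.value i : ℝ≥0∞) ^ (-1 : ℝ) * ‖⟪D.basis i, f⟫_𝕜‖ₑ ^ 2) * (D.value i : ℝ≥0∞) ^ q =
      s * ((D.value i : ℝ≥0∞) ^ (q - 1) * ‖⟪D.basis i, f⟫_𝕜‖ₑ ^ 2) := by
  obtain rfl | hs := eq_or_ne s 0
  · simp
  obtain hi | hi := eq_or_ne (D.value i) 0
  · simp [inner_basis_eq_zero h hs hi]
  · rw [sub_eq_neg_add, ENNReal.rpow_add _ _ (by simpa using hi) ENNReal.coe_ne_top]
    ring

theorem tsum_weight_mul_rpow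
    (h : ∀ y, (s : ℝ≥0∞) * ‖⟪f, y⟫_𝕜‖ₑ ^ 2 ≤ D.powForm 1 y) (q : ℝ) :
    ∑' i, s * ((D.value i : ℝ≥0∞) ^ (-1 : ℝ) * ‖⟪D.basis i, f⟫_𝕜‖ₑ ^ 2) *
      (D.value i : ℝ≥0∞) ^ q = s * D.powForm (q - 1) f := by
  simp only [mul_rpow_mul_enorm_inner_sq h, ENNReal.tsum_mul_left, powForm]

theorem tsum_weight_mul_value (hf : ‖f‖ₑ = 1)
    (h : ∀ y, (s : ℝ≥0∞) * ‖⟪f, y⟫_𝕜‖ₑ ^ 2 ≤ D.powForm 1 y) :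
    ∑' i, s * ((D.value i : ℝ≥0∞) ^ (-1 : ℝ) * ‖⟪D.basis i, f⟫_𝕜‖ₑ ^ 2) * D.value i = s := by
  simpa [powForm_zero, hf] using tsum_weight_mul_rpow h 1

theorem rpow_le_mul_powForm {q : ℝ} (hq : 1 ≤ q) (hf : ‖f‖ₑ = 1)
    (h : ∀ y, (s : ℝ≥0∞) * ‖⟪f, y⟫_𝕜‖ₑ ^ 2 ≤ D.powForm 1 y) :
    (s : ℝ≥0∞) ^ q ≤ s * D.powForm (q - 1) f := by
  have hmass := mul_powForm_neg_one_le_one h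
  rw [powForm, ← ENNReal.tsum_mul_left] at hmass
  simpa only [tsum_weight_mul_value hf h, tsum_weight_mul_rpow h]
    using rpow_tsum_mul_le hq hmass fun i => (D.value i : ℝ≥0∞)

theorem mul_powForm_le_rpow {q : ℝ} (hq : 0 < q) (hq1 : q ≤ 1) (hf : ‖f‖ₑ = 1)
    (h : ∀ y, (s : ℝ≥0∞) * ‖⟪f, y⟫_𝕜‖ₑ ^ 2 ≤ D.powForm 1 y) :
    s * D.powForm (q - 1) f ≤ (s : ℝ≥0∞) ^ q := by
  have hmass := mul_powForm_neg_one_le_one h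
  rw [powForm, ← ENNReal.tsum_mul_left] at hmass
  simpa only [tsum_weight_mul_value hf h, tsum_weight_mul_rpow h]
    using tsum_mul_rpow_le hq hq1 hmass fun i => (D.value i : ℝ≥0∞)

theorem rpow_le_powForm {q : ℝ} (hq : 0 < q) (hf : ‖f‖ₑ = 1)
    (h : ∀ y, (s : ℝ≥0∞) * ‖⟪f, y⟫_𝕜‖ₑ ^ 2 ≤ D.powForm 1 y) :
    (s : ℝ≥0∞) ^ q ≤ D.powForm q f := by
  obtain rfl | hs := eq_or_ne s 0
  · simp [hq]
  -- The exponent `1 + q` is above `1` for every `q > 0`, and the extra factor `s` cancels.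
  have hmul := rpow_le_mul_powForm (q := 1 + q) (by linarith) hf h
  rw [ENNReal.rpow_add_of_nonneg 1 q zero_le_one hq.le, ENNReal.rpow_one, add_sub_cancel_left]
    at hmul
  exact (ENNReal.mul_le_mul_iff_right (by simpa using hs) ENNReal.coe_ne_top).1 hmul

end RankOne

theorem value_mul_enorm_inner_sq_le {D : Eigenbasis T ι} {E : Eigenbasis S κ} (h : S ≤ T) (j : κ)
    (y : H) : (E.value j : ℝ≥0∞) * ‖⟪E.basis j, y⟫_𝕜‖ₑ ^ 2 ≤ D.powForm 1 y :=
  (E.value_mul_enorm_inner_sq_le_powForm_one j y).trans (powForm_one_mono h y)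

theorem powSum_mono {D : Eigenbasis T ι} {E : Eigenbasis S κ} (h : S ≤ T) {q : ℝ} (hq : 0 < q) :
    E.powSum q ≤ D.powSum q := by
  rw [← D.tsum_powForm_basis E]
  exact ENNReal.tsum_le_tsum fun j =>
    rpow_le_powForm hq (enorm_hilbertBasis _ j) (value_mul_enorm_inner_sq_le h j)

theorem powSum_le_tsum_rpow_mul_powForm {D : Eigenbasis T ι} {E : Eigenbasis S κ} (h : S ≤ T)
    {q : ℝ} (hq : 1 ≤ q) :
    E.powSum q ≤ ∑' i, (D.value i : ℝ≥0∞) ^ (q - 1) * E.powForm 1 (D.basis i) := by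
  rw [← tsum_rpow_mul_powForm]
  refine ENNReal.tsum_le_tsum fun j => ?_
  rw [ENNReal.rpow_one]
  exact rpow_le_mul_powForm hq (enorm_hilbertBasis _ j) (value_mul_enorm_inner_sq_le h j)

theorem tsum_rpow_mul_powForm_le_powSum {D : Eigenbasis T ι} {E : Eigenbasis S κ} (h : S ≤ T)
    {q : ℝ} (hq : 0 < q) (hq1 : q ≤ 1) :
    ∑' i, (D.value i : ℝ≥0∞) ^ (q - 1) * E.powForm 1 (D.basis i) ≤ E.powSum q := by
  rw [← tsum_rpow_mul_powForm]
  refine ENNReal.tsum_le_tsum fun j => ?_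
  rw [ENNReal.rpow_one]
  exact mul_powForm_le_rpow hq hq1 (enorm_hilbertBasis _ j) (value_mul_enorm_inner_sq_le h j)

section Smul

/-- The eigenbasis of a nonnegative multiple of `T`. -/
def smul (c : ℝ≥0) : Eigenbasis (((c : ℝ) : 𝕜) • T) ι where
  basis := D.basis
  value i := c * D.value i
  apply_basis i := by
    rw [smul_apply, D.apply_basis, smul_smul]
    push_cast
    rfl

theorem powSum_smul (c : ℝ≥0) {q : ℝ} (hq : 0 < q) :
    (D.smul c).powSum q = (c : ℝ≥0∞) ^ q * D.powSum q := by
  simp only [powSum, smul, ENNReal.coe_mul, ENNReal.mul_rpow_of_nonneg _ _ hq.le,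
    ENNReal.tsum_mul_left]

end Smul

section Sum

variable {m : Type*} [Fintype m] {X : m → H →L[𝕜] H} {κ : m → Type*}
  (D : Eigenbasis (∑ k, X k) ι) (E : ∀ k, Eigenbasis (X k) (κ k))

theorem le_sum_of_isPositive (hX : ∀ k, (X k).IsPositive) (k : m) : X k ≤ ∑ l, X l := by
  classical
  rw [ContinuousLinearMap.le_def, ← Finset.add_sum_erase _ _ (Finset.mem_univ k),
    add_sub_cancel_left]
  exact ContinuousLinearMap.isPositive_sum _ fun l _ => hX l

theorem sum_powForm_one (x : H) : ∑ k, (E k).powForm 1 x = D.powForm 1 x := by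
  simp only [powForm_one]
  rw [← ENNReal.ofReal_sum_of_nonneg fun k _ => (E k).isPositive.re_inner_nonneg_right x]
  simp [inner_sum]

theorem sum_tsum_rpow_mul_powForm {q : ℝ} (hq : 0 < q) :
    ∑ k, ∑' i, (D.value i : ℝ≥0∞) ^ (q - 1) * (E k).powForm 1 (D.basis i) = D.powSum q := by
  rw [← Summable.tsum_finsetSum fun _ _ => ENNReal.summable]
  refine tsum_congr fun i => ?_
  rw [← Finset.mul_sum, D.sum_powForm_one, powForm_basis]
  obtain hi | hi := eq_or_ne (D.value i) 0
  · simp [hi, hq]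
  · rw [← ENNReal.rpow_add _ _ (by simpa using hi) ENNReal.coe_ne_top, sub_add_cancel]

theorem sum_powSum_le {q : ℝ} (hq : 1 ≤ q) : ∑ k, (E k).powSum q ≤ D.powSum q := by
  rw [← D.sum_tsum_rpow_mul_powForm E (one_pos.trans_le hq)]
  exact Finset.sum_le_sum fun k _ =>
    powSum_le_tsum_rpow_mul_powForm (le_sum_of_isPositive (fun l => (E l).isPositive) k) hq

theorem powSum_sum_le {q : ℝ} (hq : 0 < q) (hq1 : q ≤ 1) : D.powSum q ≤ ∑ k, (E k).powSum q := by
  rw [← D.sum_tsum_rpow_mul_powForm E hq]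
  exact Finset.sum_le_sum fun k _ =>
    tsum_rpow_mul_powForm_le_powSum (le_sum_of_isPositive (fun l => (E l).isPositive) k) hq hq1

theorem powSum_sum_le_card_rpow_mul {q : ℝ} (hq : 1 ≤ q) :
    D.powSum q ≤ (Fintype.card m : ℝ≥0∞) ^ (q - 1) * ∑ k, (E k).powSum q := by
  calc D.powSum q = ∑' i, (∑ k, (E k).powForm 1 (D.basis i)) ^ q := by
        simp only [powSum, D.sum_powForm_one, powForm_basis, ENNReal.rpow_one]
    _ ≤ ∑' i, (Fintype.card m : ℝ≥0∞) ^ (q - 1) * ∑ k, (E k).powForm q (D.basis i) := by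
        refine ENNReal.tsum_le_tsum fun i =>
          (ENNReal.rpow_sum_le_const_mul_sum_rpow _ _ hq).trans ?_
        rw [Finset.card_univ]
        gcongr with k
        exact (E k).rpow_powForm_one_le hq (enorm_hilbertBasis _ i)
    _ = (Fintype.card m : ℝ≥0∞) ^ (q - 1) * ∑ k, (E k).powSum q := by
        rw [ENNReal.tsum_mul_left, Summable.tsum_finsetSum fun _ _ => ENNReal.summable]
        simp only [tsum_powForm_basis]

end Sum

end Eigenbasis

theorem exists_hilbertBasis_forall_exists_mem {V : ι → Submodule 𝕜 H} [∀ i, CompleteSpace (V i)]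
    [CompleteSpace H] (hV : OrthogonalFamily 𝕜 (fun i => V i) fun i => (V i).subtypeₗᵢ)
    (hbot : (⨆ i, V i)ᗮ = ⊥) :
    ∃ (w : Set H) (b : HilbertBasis w 𝕜 H), ∀ k, ∃ i, b k ∈ V i := by
  classical
  choose w b _ using fun i => exists_hilbertBasis 𝕜 (V i)
  have hortho : Orthonormal 𝕜 fun a : Σ i, w i => (b a.1 a.2 : H) :=
    hV.orthonormal_sigma_orthonormal fun i => (b i).orthonormal
  have hspan : (Submodule.span 𝕜 (Set.range ((↑) : Set.range
      (fun a : Σ i, w i => (b a.1 a.2 : H)) → H)))ᗮ = ⊥ := by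
    rw [Subtype.range_coe, eq_bot_iff, ← hbot, ← Submodule.iInf_orthogonal]
    refine fun x hx => Submodule.mem_iInf _ |>.2 fun i => ?_
    rw [← Submodule.orthogonalProjectionOnto_eq_zero_iff]
    refine (b i).repr.injective (Subtype.ext (funext fun j => ?_))
    rw [(b i).repr_apply_apply, Submodule.inner_orthogonalProjectionOnto_eq_of_mem_left, map_zero]
    exact hx _ (Submodule.subset_span ⟨⟨i, j⟩, rfl⟩)
  refine ⟨_, HilbertBasis.mkOfOrthogonalEqBot hortho.toSubtypeRange hspan, ?_⟩
  rintro ⟨_, ⟨i, j⟩, rfl⟩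
  exact ⟨i, by simp⟩

/-- The sum of the `q`-th powers of the nonnegative eigenvalues of `T`, counted with multiplicity,
that is, `tr T ^ q` for `q > 0` and a positive compact operator `T`. -/
noncomputable def eigenSum (q : ℝ) (T : H →L[𝕜] H) : ℝ≥0∞ :=
  ∑' r : ℝ≥0, (Module.finrank 𝕜 (Module.End.eigenspace (T : H →ₗ[𝕜] H) ((r : ℝ) : 𝕜)) : ℝ≥0∞) *
    (r : ℝ≥0∞) ^ q

namespace Eigenbasis

variable {S T : H →L[𝕜] H} (D : Eigenbasis T ι)

theorem inner_basis_eq_zero_of_mem_eigenspace {r : ℝ≥0} {x : H}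
    (hx : x ∈ Module.End.eigenspace (T : H →ₗ[𝕜] H) ((r : ℝ) : 𝕜)) {i : ι} (hi : D.value i ≠ r) :
    ⟪D.basis i, x⟫_𝕜 = 0 := by
  have h := D.inner_basis_apply i x
  rw [← ContinuousLinearMap.coe_coe, Module.End.mem_eigenspace_iff.1 hx, inner_smul_right] at h
  by_contra h0
  exact hi (NNReal.coe_injective (RCLike.ofReal_injective (mul_right_cancel₀ h0 h.symm)))

theorem span_eq_eigenspace {r : ℝ≥0} (hfin : (D.value ⁻¹' {r}).Finite) :
    Submodule.span 𝕜 (D.basis '' (D.value ⁻¹' {r})) =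
      Module.End.eigenspace (T : H →ₗ[𝕜] H) ((r : ℝ) : 𝕜) := by
  refine le_antisymm (Submodule.span_le.2 ?_) fun x hx => ?_
  · rintro _ ⟨i, rfl, rfl⟩
    exact Module.End.mem_eigenspace_iff.2 (D.apply_basis i)
  · have hsum := D.basis.hasSum_repr x
    rw [← (hasSum_sum_of_ne_finset_zero (s := hfin.toFinset) fun i hi => ?_).unique hsum]
    · refine Submodule.sum_mem _ fun i hi => Submodule.smul_mem _ _ (Submodule.subset_span ?_)
      exact Set.mem_image_of_mem _ (hfin.mem_toFinset.1 hi)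
    · rw [D.basis.repr_apply_apply, D.inner_basis_eq_zero_of_mem_eigenspace hx
        fun h => hi (hfin.mem_toFinset.2 h), zero_smul]

variable [CompleteSpace H]

theorem finite_value_preimage (hc : IsCompactOperator T) {r : ℝ≥0} (hr : r ≠ 0) :
    (D.value ⁻¹' {r}).Finite := by
  have := ContinuousLinearMap.finite_dimensional_eigenspace hc ((r : ℝ) : 𝕜) (by simpa using hr)
  let v (i : D.value ⁻¹' {r}) : Module.End.eigenspace (T : H →ₗ[𝕜] H) ((r : ℝ) : 𝕜) :=
    ⟨D.basis i, Module.End.mem_eigenspace_iff.2 ((D.apply_basis i).trans <| by rw [i.2])⟩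
  have hv : LinearIndependent 𝕜 v := .of_comp (Submodule.subtype _) <|
    D.basis.orthonormal.linearIndependent.comp _ Subtype.val_injective
  exact Set.finite_coe_iff.1 hv.finite

theorem finrank_eigenspace (hc : IsCompactOperator T) {r : ℝ≥0} (hr : r ≠ 0) :
    Module.finrank 𝕜 (Module.End.eigenspace (T : H →ₗ[𝕜] H) ((r : ℝ) : 𝕜)) =
      Nat.card (D.value ⁻¹' {r}) := by
  have hfin := D.finite_value_preimage hc hr
  have := hfin.fintype
  have hli : LinearIndependent 𝕜 fun i : D.value ⁻¹' {r} => D.basis i :=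
    D.basis.orthonormal.linearIndependent.comp _ Subtype.val_injective
  rw [← D.span_eq_eigenspace hfin, Set.image_eq_range, finrank_span_eq_card hli,
    Nat.card_eq_fintype_card]

theorem powSum_eq_eigenSum (hc : IsCompactOperator T) {q : ℝ} (hq : 0 < q) :
    D.powSum q = eigenSum q T := by
  rw [powSum, ← ENNReal.tsum_fiberwise _ D.value, eigenSum]
  refine tsum_congr fun r => ?_
  have hconst : ∑' i : D.value ⁻¹' {r}, (D.value i : ℝ≥0∞) ^ q =
      ENat.card (D.value ⁻¹' {r}) * (r : ℝ≥0∞) ^ q := by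
    rw [← ENNReal.tsum_const]
    exact tsum_congr fun i => by rw [i.2]
  rw [hconst]
  obtain rfl | hr := eq_or_ne r 0
  · simp [hq]
  · have := (D.finite_value_preimage hc hr).to_subtype
    rw [D.finrank_eigenspace hc hr, ENat.card_eq_coe_natCard]
    norm_cast

end Eigenbasis

section Spectral

variable {S T : H →L[𝕜] H}

theorem isCompactOperator_sum {m : Type*} {X : m → H →L[𝕜] H} (s : Finset m)
    (hc : ∀ k, IsCompactOperator (X k)) : IsCompactOperator (∑ k ∈ s, X k : H →L[𝕜] H) :=
  Submodule.sum_mem (compactOperator (RingHom.id 𝕜) H H) fun k _ => hc k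

theorem eigenspace_mul_self (hT : T.IsPositive) {s : ℝ} (hs : 0 < s) :
    Module.End.eigenspace ((T * T : H →L[𝕜] H) : H →ₗ[𝕜] H) ((s ^ 2 : ℝ) : 𝕜) =
      Module.End.eigenspace (T : H →ₗ[𝕜] H) (s : 𝕜) := by
  ext x
  simp only [Module.End.mem_eigenspace_iff, ContinuousLinearMap.coe_coe, mul_apply_eq_comp]
  refine ⟨fun h => ?_, fun h => by rw [h, map_smul, h, smul_smul, RCLike.ofReal_pow, sq]⟩
  have hy : T (T x - (s : 𝕜) • x) = ((-s : ℝ) : 𝕜) • (T x - (s : 𝕜) • x) := by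
    rw [map_sub, map_smul, h]
    push_cast
    module
  by_contra hne
  have hneg : Module.End.HasEigenvalue (T : H →ₗ[𝕜] H) ((-s : ℝ) : 𝕜) :=
    Module.End.hasEigenvalue_of_hasEigenvector
      ⟨Module.End.mem_eigenspace_iff.2 hy, sub_ne_zero.2 hne⟩
  linarith [eigenvalue_nonneg_of_nonneg hneg hT.re_inner_nonneg_right]

theorem eigenSum_mul_self (hT : T.IsPositive) {q : ℝ} (hq : 0 < q) :
    eigenSum q (T * T) = eigenSum (2 * q) T := by
  let square : ℝ≥0 ≃ ℝ≥0 := ⟨(· ^ 2), NNReal.sqrt, NNReal.sqrt_sq, NNReal.sq_sqrt⟩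
  rw [eigenSum, eigenSum, ← square.tsum_eq]
  refine tsum_congr fun r => ?_
  obtain rfl | hr := eq_or_ne r 0
  · simp [square, hq]
  · rw [Equiv.coe_fn_mk, NNReal.coe_pow,
      eigenspace_mul_self hT (NNReal.coe_pos.2 (pos_iff_ne_zero.2 hr)), ENNReal.coe_pow,
      ← ENNReal.rpow_natCast, ← ENNReal.rpow_mul, Nat.cast_ofNat]

variable [CompleteSpace H]

theorem exists_eigenbasis (hc : IsCompactOperator T) (hT : T.IsPositive) :
    ∃ w : Set H, Nonempty (Eigenbasis T w) := by
  have hclosed (μ : 𝕜) : CompleteSpace (Module.End.eigenspace (T : H →ₗ[𝕜] H) μ) :=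
    (T.isClosed_eigenspace μ).completeSpace_coe
  obtain ⟨w, b, hb⟩ := exists_hilbertBasis_forall_exists_mem
    (LinearMap.IsSymmetric.orthogonalFamily_eigenspaces hT.isSymmetric)
    (ContinuousLinearMap.orthogonalComplement_iSup_eigenspaces_eq_bot hc hT.isSymmetric)
  choose μ hμ using hb
  have hvalue (k : w) : ∃ r : ℝ≥0, ((r : ℝ) : 𝕜) = μ k := by
    have hnonneg := hT.inner_nonneg_right (b k)
    rw [← ContinuousLinearMap.coe_coe, Module.End.mem_eigenspace_iff.1 (hμ k), inner_smul_right,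
      inner_self_eq_norm_sq_to_K, b.orthonormal.norm_eq_one, RCLike.ofReal_one, one_pow, mul_one,
      RCLike.nonneg_iff_exists_ofReal] at hnonneg
    obtain ⟨r, hr, hrμ⟩ := hnonneg
    exact ⟨⟨r, hr⟩, hrμ⟩
  choose r hr using hvalue
  exact ⟨w, ⟨b, r, fun k => by rw [hr]; exact Module.End.mem_eigenspace_iff.1 (hμ k)⟩⟩

theorem eigenSum_smul (hc : IsCompactOperator T) (hT : T.IsPositive) (c : ℝ≥0) {q : ℝ}
    (hq : 0 < q) : eigenSum q (((c : ℝ) : 𝕜) • T) = (c : ℝ≥0∞) ^ q * eigenSum q T := by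
  obtain ⟨_, ⟨D⟩⟩ := exists_eigenbasis hc hT
  rw [← D.powSum_eq_eigenSum hc hq, ← (D.smul c).powSum_eq_eigenSum (hc.smul _) hq,
    D.powSum_smul c hq]

theorem eigenSum_mono (hSc : IsCompactOperator S) (hS : S.IsPositive) (hTc : IsCompactOperator T)
    (h : S ≤ T) {q : ℝ} (hq : 0 < q) : eigenSum q S ≤ eigenSum q T := by
  have hT : T.IsPositive := by
    simpa using ((ContinuousLinearMap.le_def _ _).1 h).add hS
  obtain ⟨_, ⟨D⟩⟩ := exists_eigenbasis hTc hT
  obtain ⟨_, ⟨E⟩⟩ := exists_eigenbasis hSc hS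
  rw [← D.powSum_eq_eigenSum hTc hq, ← E.powSum_eq_eigenSum hSc hq]
  exact Eigenbasis.powSum_mono h hq

section Sum

variable {m : Type*} [Fintype m] {X : m → H →L[𝕜] H} (hc : ∀ k, IsCompactOperator (X k))
  (hX : ∀ k, (X k).IsPositive) {q : ℝ}

include hc hX

theorem sum_eigenSum_le (hq : 1 ≤ q) : ∑ k, eigenSum q (X k) ≤ eigenSum q (∑ k, X k) := by
  have hsum := isCompactOperator_sum Finset.univ hc
  obtain ⟨_, ⟨D⟩⟩ := exists_eigenbasis hsum (ContinuousLinearMap.isPositive_sum _ fun k _ => hX k)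
  choose _ E using fun k => exists_eigenbasis (hc k) (hX k)
  have hq0 : 0 < q := one_pos.trans_le hq
  rw [← D.powSum_eq_eigenSum hsum hq0]
  simp only [← fun k => (E k).some.powSum_eq_eigenSum (hc k) hq0]
  exact D.sum_powSum_le (fun k => (E k).some) hq

theorem eigenSum_sum_le (hq : 0 < q) (hq1 : q ≤ 1) :
    eigenSum q (∑ k, X k) ≤ ∑ k, eigenSum q (X k) := by
  have hsum := isCompactOperator_sum Finset.univ hc
  obtain ⟨_, ⟨D⟩⟩ := exists_eigenbasis hsum (ContinuousLinearMap.isPositive_sum _ fun k _ => hX k)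
  choose _ E using fun k => exists_eigenbasis (hc k) (hX k)
  rw [← D.powSum_eq_eigenSum hsum hq]
  simp only [← fun k => (E k).some.powSum_eq_eigenSum (hc k) hq]
  exact D.powSum_sum_le (fun k => (E k).some) hq hq1

theorem eigenSum_sum_le_card_rpow_mul (hq : 1 ≤ q) :
    eigenSum q (∑ k, X k) ≤ (Fintype.card m : ℝ≥0∞) ^ (q - 1) * ∑ k, eigenSum q (X k) := by
  have hsum := isCompactOperator_sum Finset.univ hc
  obtain ⟨_, ⟨D⟩⟩ := exists_eigenbasis hsum (ContinuousLinearMap.isPositive_sum _ fun k _ => hX k)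
  choose _ E using fun k => exists_eigenbasis (hc k) (hX k)
  have hq0 : 0 < q := one_pos.trans_le hq
  rw [← D.powSum_eq_eigenSum hsum hq0]
  simp only [← fun k => (E k).some.powSum_eq_eigenSum (hc k) hq0]
  exact D.powSum_sum_le_card_rpow_mul (fun k => (E k).some) hq

theorem eigenSum_sum_lt_top (hq : 0 < q) (h : ∀ k, eigenSum q (X k) < ∞) :
    eigenSum q (∑ k, X k) < ∞ := by
  have hlt : ∑ k, eigenSum q (X k) < ∞ := ENNReal.sum_lt_top.2 fun k _ => h k
  obtain hq1 | hq1 := le_total q 1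
  · exact (eigenSum_sum_le hc hX hq hq1).trans_lt hlt
  · exact (eigenSum_sum_le_card_rpow_mul hc hX hq1).trans_lt <| ENNReal.mul_lt_top
      (ENNReal.rpow_lt_top_of_nonneg (sub_nonneg.2 hq1) (ENNReal.natCast_ne_top _)) hlt

end Sum

end Spectral

end Eigenvalues

section SingularValues

variable {H m : Type*} [NormedAddCommGroup H] [InnerProductSpace ℂ H] [CompleteSpace H]
  [Fintype m] {p : ℝ} {X P : H →L[ℂ] H}

theorem isCompactOperator_star_mul_self (hX : IsCompactOperator X) :
    IsCompactOperator (star X * X : H →L[ℂ] H) :=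
  hX.clm_comp (star X)

theorem singularSum_eq_eigenSum_abs (hp : 0 < p) (X : H →L[ℂ] H) :
    singularSum p X = eigenSum p (CFC.abs X) := by
  let toNNReal (s : {s : ℝ // 0 < s}) : ℝ≥0 := ⟨s, s.2.le⟩
  have hinj : Function.Injective toNNReal := fun s t h =>
    Subtype.ext (congrArg ((↑) : ℝ≥0 → ℝ) h)
  rw [eigenSum, ← hinj.tsum_eq fun r hr => ?_]
  · refine tsum_congr fun s => ?_
    rw [← ENNReal.ofReal_rpow_of_pos s.2, ← ENNReal.ofReal_coe_nnreal]
    rfl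
  · refine ⟨⟨r, NNReal.coe_pos.2 (pos_iff_ne_zero.2 ?_)⟩, rfl⟩
    rintro rfl
    simp [hp] at hr

theorem singularSum_eq_eigenSum_star_mul_self (hp : 0 < p) (X : H →L[ℂ] H) :
    singularSum p X = eigenSum (p / 2) (star X * X) := by
  have habs := (ContinuousLinearMap.nonneg_iff_isPositive _).1 (CFC.abs_nonneg X)
  rw [← CFC.abs_mul_abs, eigenSum_mul_self habs (half_pos hp), mul_div_cancel₀ p two_ne_zero,
    singularSum_eq_eigenSum_abs hp]

theorem singularSum_eq_eigenSum_of_isPositive (hp : 0 < p) (hP : P.IsPositive) :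
    singularSum p P = eigenSum p P := by
  rw [singularSum_eq_eigenSum_abs hp,
    CFC.abs_of_nonneg P ((ContinuousLinearMap.nonneg_iff_isPositive P).2 hP)]

theorem singularSum_smul (hp : 0 < p) (hX : IsCompactOperator X) (c : ℂ) :
    singularSum p (c • X) = ‖c‖ₑ ^ p * singularSum p X := by
  have hsmul : star (c • X) * (c • X) =
      (RCLike.ofReal (‖c‖₊ ^ 2 : ℝ≥0) : ℂ) • (star X * X) := by
    rw [star_smul, smul_mul_smul_comm, RCLike.star_def, RCLike.conj_mul]
    norm_cast
  rw [singularSum_eq_eigenSum_star_mul_self hp, singularSum_eq_eigenSum_star_mul_self hp, hsmul,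
    eigenSum_smul (isCompactOperator_star_mul_self hX) X.isPositive_adjoint_comp_self _
      (half_pos hp), ENNReal.coe_pow, ← ENNReal.rpow_natCast, ← ENNReal.rpow_mul, Nat.cast_ofNat,
    mul_div_cancel₀ p two_ne_zero, enorm_eq_nnnorm]

theorem schattenNorm_rpow (hp : 0 < p) (X : H →L[ℂ] H) :
    schattenNorm p X ^ p = (singularSum p X).toReal := by
  rw [schattenNorm, one_div, Real.rpow_inv_rpow ENNReal.toReal_nonneg hp.ne']

theorem MemSchatten.smul (hp : 0 < p) (hX : MemSchatten p X) (c : ℂ) : MemSchatten p (c • X) := by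
  refine ⟨hX.1.smul c, ?_⟩
  rw [singularSum_smul hp hX.1]
  exact ENNReal.mul_lt_top (ENNReal.rpow_lt_top_of_nonneg hp.le enorm_ne_top) hX.2

theorem schattenNorm_smul_rpow (hp : 0 < p) (hX : IsCompactOperator X) (c : ℂ) :
    schattenNorm p (c • X) ^ p = ‖c‖ ^ p * schattenNorm p X ^ p := by
  rw [schattenNorm_rpow hp, schattenNorm_rpow hp, singularSum_smul hp hX, ENNReal.toReal_mul,
    ← ENNReal.toReal_rpow, toReal_enorm]

theorem MemSchatten.of_star_mul_self_le (hp : 0 < p) (hX : IsCompactOperator X)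
    (hP : MemSchatten (p / 2) P) (hle : star X * X ≤ P) : MemSchatten p X := by
  have hPpos : P.IsPositive :=
    (ContinuousLinearMap.nonneg_iff_isPositive P).1 ((star_mul_self_nonneg X).trans hle)
  refine ⟨hX, lt_of_le_of_lt ?_ hP.2⟩
  rw [singularSum_eq_eigenSum_star_mul_self hp,
    singularSum_eq_eigenSum_of_isPositive (half_pos hp) hPpos]
  exact eigenSum_mono (isCompactOperator_star_mul_self hX) X.isPositive_adjoint_comp_self hP.1 hle
    (half_pos hp)

theorem isPositive_sum_star_mul_self (X : m → H →L[ℂ] H) : (∑ k, star (X k) * X k).IsPositive :=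
  ContinuousLinearMap.isPositive_sum _ fun k _ => (X k).isPositive_adjoint_comp_self

theorem MemSchatten.sum_star_mul_self {X : m → H →L[ℂ] H} (hp : 0 < p)
    (hX : ∀ k, MemSchatten p (X k)) : MemSchatten (p / 2) (∑ k, star (X k) * X k) := by
  have hc k := isCompactOperator_star_mul_self (hX k).1
  refine ⟨isCompactOperator_sum _ hc, ?_⟩
  rw [singularSum_eq_eigenSum_of_isPositive (half_pos hp) (isPositive_sum_star_mul_self X)]
  refine eigenSum_sum_lt_top hc (fun k => (X k).isPositive_adjoint_comp_self) (half_pos hp)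
    fun k => ?_
  rw [← singularSum_eq_eigenSum_star_mul_self hp]
  exact (hX k).2

theorem sum_schattenNorm_rpow {X : m → H →L[ℂ] H} (hp : 0 < p) (hX : ∀ k, MemSchatten p (X k)) :
    ∑ k, schattenNorm p (X k) ^ p = (∑ k, eigenSum (p / 2) (star (X k) * X k)).toReal := by
  simp only [schattenNorm_rpow hp, ← singularSum_eq_eigenSum_star_mul_self hp]
  exact (ENNReal.toReal_sum fun k _ => (hX k).2.ne).symm

theorem sum_schattenNorm_rpow_le {X : m → H →L[ℂ] H} (hp : 2 ≤ p)
    (hX : ∀ k, MemSchatten p (X k)) :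
    ∑ k, schattenNorm p (X k) ^ p ≤
      schattenNorm (p / 2) (∑ k, star (X k) * X k) ^ (p / 2) := by
  have hp0 : 0 < p := two_pos.trans_le hp
  have hP := isPositive_sum_star_mul_self X
  have htop := (MemSchatten.sum_star_mul_self hp0 hX).2.ne
  rw [sum_schattenNorm_rpow hp0 hX, schattenNorm_rpow (half_pos hp0)]
  rw [singularSum_eq_eigenSum_of_isPositive (half_pos hp0) hP] at htop ⊢
  exact ENNReal.toReal_mono htop <|
    sum_eigenSum_le (fun k => isCompactOperator_star_mul_self (hX k).1)
      (fun k => (X k).isPositive_adjoint_comp_self) (by linarith)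

theorem schattenNorm_sum_rpow_le {X : m → H →L[ℂ] H} (hp : 0 < p) (hp2 : p ≤ 2)
    (hX : ∀ k, MemSchatten p (X k)) :
    schattenNorm (p / 2) (∑ k, star (X k) * X k) ^ (p / 2) ≤
      ∑ k, schattenNorm p (X k) ^ p := by
  have htop : ∑ k, eigenSum (p / 2) (star (X k) * X k) ≠ ∞ := by
    simp only [← singularSum_eq_eigenSum_star_mul_self hp]
    exact (ENNReal.sum_lt_top.2 fun k _ => (hX k).2).ne
  rw [sum_schattenNorm_rpow hp hX, schattenNorm_rpow (half_pos hp),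
    singularSum_eq_eigenSum_of_isPositive (half_pos hp) (isPositive_sum_star_mul_self X)]
  exact ENNReal.toReal_mono htop <|
    eigenSum_sum_le (fun k => isCompactOperator_star_mul_self (hX k).1)
      (fun k => (X k).isPositive_adjoint_comp_self) (half_pos hp) (by linarith)

end SingularValues

section Fourier

theorem sum_star_mul_self_of_conjTranspose_mul_self {R A ι κ : Type*} [CommSemiring R] [StarRing R]
    [NonUnitalSemiring A] [StarRing A] [Module R A] [IsScalarTower R A A] [SMulCommClass R A A]
    [StarModule R A] [Fintype ι] [Fintype κ] [DecidableEq ι] {U : Matrix κ ι R} {c : R}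
    (hU : Uᴴ * U = c • 1) (a : ι → A) :
    ∑ k, star (∑ j, U k j • a j) * ∑ j, U k j • a j = c • ∑ j, star (a j) * a j := by
  have hentry (i j : ι) : ∑ k, star (U k i) * U k j = if i = j then c else 0 := by
    simpa [Matrix.mul_apply, Matrix.one_apply] using congrFun₂ hU i j
  simp only [star_sum, star_smul, Finset.sum_mul_sum, smul_mul_smul_comm]
  rw [Finset.sum_comm, Finset.smul_sum]
  refine Finset.sum_congr rfl fun i _ => ?_
  rw [Finset.sum_comm]
  simp only [← Finset.sum_smul, hentry, ite_smul, zero_smul, Finset.sum_ite_eq, Finset.mem_univ,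
    if_true]

theorem sum_range_pow_eq_ite {R : Type*} [CommRing R] [IsDomain R] [DecidableEq R] {z : R} {n : ℕ}
    (hz : z ^ n = 1) : ∑ k ∈ Finset.range n, z ^ k = if z = 1 then (n : R) else 0 := by
  split_ifs with h
  · simp [h]
  · have hmul : (z - 1) * ∑ k ∈ Finset.range n, z ^ k = 0 := by rw [mul_geom_sum, hz, sub_self]
    exact (mul_eq_zero.1 hmul).resolve_left (sub_ne_zero.2 h)

theorem rootOfUnity_eq_pow (n j : ℕ) :
    rootOfUnity n j = Complex.exp (2 * Real.pi * Complex.I / n) ^ j := by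
  rw [rootOfUnity, ← Complex.exp_nat_mul]
  ring_nf

theorem rootOfUnity_pow_eq_one {n : ℕ} (hn : n ≠ 0) (j : ℕ) : rootOfUnity n j ^ n = 1 := by
  rw [rootOfUnity_eq_pow, pow_right_comm, (Complex.isPrimitiveRoot_exp n hn).pow_eq_one, one_pow]

theorem rootOfUnity_injective (n : ℕ) : Function.Injective fun j : Fin n => rootOfUnity n j := by
  intro i j h
  simp only [rootOfUnity_eq_pow] at h
  exact Fin.ext ((Complex.isPrimitiveRoot_exp n i.pos.ne').pow_inj i.2 j.2 h)

/-- The matrix of the discrete Fourier transform on `ℂⁿ`, with rows and columns counted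
from `0`. -/
noncomputable def fourierMatrix (n : ℕ) : Matrix (Fin n) (Fin n) ℂ :=
  .of fun k j => rootOfUnity n j ^ (k : ℕ)

theorem conjTranspose_fourierMatrix_mul_self (n : ℕ) :
    (fourierMatrix n)ᴴ * fourierMatrix n = (n : ℂ) • 1 := by
  ext i j
  have hn : n ≠ 0 := i.pos.ne'
  have hinv : star (rootOfUnity n i) = (rootOfUnity n i)⁻¹ :=
    (Complex.inv_eq_conj (Complex.norm_eq_one_of_pow_eq_one (rootOfUnity_pow_eq_one hn i) hn)).symm
  have hne : rootOfUnity n i ≠ 0 := Complex.exp_ne_zero _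
  have hpow : ((rootOfUnity n i)⁻¹ * rootOfUnity n j) ^ n = 1 := by
    rw [mul_pow, inv_pow, rootOfUnity_pow_eq_one hn, rootOfUnity_pow_eq_one hn, inv_one, one_mul]
  simp only [fourierMatrix, Matrix.mul_apply, Matrix.conjTranspose_apply, Matrix.of_apply, star_pow,
    hinv, ← mul_pow, Matrix.smul_apply, Matrix.one_apply, smul_eq_mul, mul_ite, mul_one, mul_zero]
  rw [Fin.sum_univ_eq_sum_range (((rootOfUnity n i)⁻¹ * rootOfUnity n j) ^ ·),
    sum_range_pow_eq_ite hpow]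
  simp only [inv_mul_eq_one₀ hne, (rootOfUnity_injective n).eq_iff]

end Fourier

end Schatten

theorem mainTheorem12_general {H ι κ : Type*} [NormedAddCommGroup H] [InnerProductSpace ℂ H]
    [CompleteSpace H] [Fintype ι] [Fintype κ] [DecidableEq ι] {U : Matrix κ ι ℂ} {c : ℝ≥0}
    (hU : Uᴴ * U = (c : ℂ) • 1) {p : ℝ} (hp : 0 < p) {A : ι → (H →L[ℂ] H)}
    (hA : ∀ j, Schatten.MemSchatten p (A j)) :
    (∀ k, Schatten.MemSchatten p (∑ j, U k j • A j)) ∧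
    Schatten.MemSchatten (p / 2) (∑ j, CFC.abs (A j) ^ 2) ∧
    (2 ≤ p →
      ∑ k, Schatten.schattenNorm p (∑ j, U k j • A j) ^ p ≤
        (c : ℝ) ^ (p / 2) *
          Schatten.schattenNorm (p / 2) (∑ j, CFC.abs (A j) ^ 2) ^ (p / 2)) ∧
    (p ≤ 2 →
      (c : ℝ) ^ (p / 2) *
          Schatten.schattenNorm (p / 2) (∑ j, CFC.abs (A j) ^ 2) ^ (p / 2) ≤
        ∑ k, Schatten.schattenNorm p (∑ j, U k j • A j) ^ p) := by
  simp only [CFC.abs_sq]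
  have hP := Schatten.MemSchatten.sum_star_mul_self hp hA
  have hsum := Schatten.sum_star_mul_self_of_conjTranspose_mul_self hU A
  have hB (k : κ) : Schatten.MemSchatten p (∑ j, U k j • A j) := by
    refine .of_star_mul_self_le hp (Schatten.isCompactOperator_sum _ fun j => (hA j).1.smul _)
      (hP.smul (half_pos hp) c) ?_
    rw [← hsum]
    exact Finset.single_le_sum (f := fun k => star (∑ j, U k j • A j) * ∑ j, U k j • A j)
      (fun k _ => star_mul_self_nonneg _) (Finset.mem_univ k)
  have hnorm := Schatten.schattenNorm_smul_rpow (half_pos hp) hP.1 c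
  rw [← hsum, Complex.norm_of_nonneg c.coe_nonneg] at hnorm
  rw [← hnorm]
  exact ⟨hB, hP, fun h => Schatten.sum_schattenNorm_rpow_le h hB,
    fun h => Schatten.schattenNorm_sum_rpow_le hp h hB⟩

-- With `j k : Fin n` counted from `0`, `rootOfUnity n j ^ k` is the
-- coefficient `ω_{j-1}^{k-1}` with `j` and `k` counted from `1`.
theorem mainTheorem12 {H : Type*} [NormedAddCommGroup H] [InnerProductSpace ℂ H]
    [CompleteSpace H] (n : ℕ) (p : ℝ) (hp : 0 < p) (A : Fin n → (H →L[ℂ] H))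
    (hA : ∀ j, Schatten.MemSchatten p (A j)) :
    (∀ k : Fin n,
      Schatten.MemSchatten p
        (∑ j : Fin n, (Schatten.rootOfUnity n (j : ℕ) ^ (k : ℕ)) • A j)) ∧
    Schatten.MemSchatten (p / 2) (∑ j : Fin n, CFC.abs (A j) ^ 2) ∧
    (2 ≤ p →
      ∑ k : Fin n,
          Schatten.schattenNorm p
            (∑ j : Fin n, (Schatten.rootOfUnity n (j : ℕ) ^ (k : ℕ)) • A j) ^ p ≤
        (n : ℝ) ^ (p / 2) *
          Schatten.schattenNorm (p / 2) (∑ j : Fin n, CFC.abs (A j) ^ 2) ^ (p / 2)) ∧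
    (p ≤ 2 →
      (n : ℝ) ^ (p / 2) *
          Schatten.schattenNorm (p / 2) (∑ j : Fin n, CFC.abs (A j) ^ 2) ^ (p / 2) ≤
        ∑ k : Fin n,
          Schatten.schattenNorm p
            (∑ j : Fin n, (Schatten.rootOfUnity n (j : ℕ) ^ (k : ℕ)) • A j) ^ p) := by
  have hU : (Schatten.fourierMatrix n)ᴴ * Schatten.fourierMatrix n = ((n : ℝ≥0) : ℂ) • 1 := by
    simpa using Schatten.conjTranspose_fourierMatrix_mul_self n
  simpa only [Schatten.fourierMatrix, Matrix.of_apply, NNReal.coe_natCast] using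
    mainTheorem12_general hU hp hA
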